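/- Let $\mathcal G=(\mathcal V,\mathcal E)$, $\mathcal V=\{1,\dots,P\}$, be a connected undirected graph with a proper coloring $C(\cdot):\mathcal V\to\{1,\dots,C\}$; let $\mathcal C_c$ be the set of nodes of color $c$ and $\mathcal N_p$ the set of neighbors of $p$. For each node $p$ let $S_p\subseteq\{1,\dots,n\}$ and let $f_p:\mathbb R^{S_p}\to\mathbb R\cup\{+\infty\}$ be closed, proper and convex. For $x\in\mathbb R^n$ write $x_{S_p}=(x_l)_{l\in S_p}$, and consider the problem $$\min_{x\in\mathbb R^n}\ f_1(x_{S_1})+\dots+f_P(x_{S_P}).\qquad(2)$$ For each $l$ let $\mathcal V_l=\{p: l\in S_p\}$ and let $\mathcal G_l=(\mathcal V_l,\mathcal E_l)$ be the subgraph of $\mathcal G$ induced by $\mathcal V_l$. Assume: * no component is shared by all nodes: $\bigcap_p S_p=\emptyset$; * the variable is connected: every $\mathcal G_l$ is connected; moreover every component appears in at least two nodes: $|\mathcal V_l|\ge 2$; * the problem is solvable, in the sense that its reformulation with copies, i.e. minimizing $\sum_p f_p(x^{(p)}_{S_p})$ over all families of vectors $x^{(p)}_{S_p}=(x^{(p)}_l)_{l\in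 S_p}$, $p\in\mathcal V$, subject to $x_l^{(i)}=x_l^{(j)}$ for all $l$ and all $(i,j)\in\mathcal E_l$, $i<j$, has a primal-dual solution: there are a feasible family of copies and multipliers $\lambda_l^{ij}\in\mathbb R$ such that this family minimizes the Lagrangian $\sum_p f_p(x^{(p)}_{S_p})+\sum_l\sum_{(i,j)\in\mathcal E_l,\,i<j}\lambda_l^{ij}(x_l^{(i)}-x_l^{(j)})$ over all families of copies; * either $C=2$ (the network is bipartite), or, for each $c=1,\dots,C$, the function $\sum_{p\in\mathcal C_c}f_p(x_{S_p})$ is strongly convex as a function of $(x_l)_{l\in\bigcup_{p\in\mathcal C_c}S_p}$. Let $\rho>0$, let $D_{p,l}=|\mathcal N_p\cap\mathcal V_l|$, and consider the following algorithm. Start with $\gamma_l^{(p),1}=x_l^{(p),1}=0$ for all $p$ and all $l\in S_p$. At iteration $k=1,2,\dots$, successively for the colors $c=1,\dots,C$, every node $p\in\mathcal C_c$ computes, for $l\in S_p$, $$v_l^{(p),k}=\gamma_l^{(p),k}-\rho\sum_{j\in\mathcal N_p\cap\mathcal V_l,\ C(j)<c}x_l^{(j),k+1}-\rho\sum_{j\in\mathcal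 N_p\cap\mathcal V_l,\ C(j)>c}x_l^{(j),k}$$ and takes as $x^{(p),k+1}_{S_p}$ a minimizer over $y\in\mathbb R^{S_p}$ of $$f_p(y)+\sum_{l\in S_p}v_l^{(p),k}y_l+\frac\rho2\sum_{l\in S_p}D_{p,l}\,y_l^2 .$$ After all colors, $\gamma_l^{(p),k+1}=\gamma_l^{(p),k}+\rho\sum_{j\in\mathcal N_p\cap\mathcal V_l}(x_l^{(p),k+1}-x_l^{(j),k+1})$ for all $p$ and $l\in S_p$. Then the algorithm can be run (all the minimizers exist), and for every sequence that it produces there is a solution $x^\star$ of (2) such that, at every node $p$, $x_{S_p}^{(p),k}\to x^\star_{S_p}$ as $k\to\infty$. -/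

import Mathlib

namespace PartialADMM

/-- A function `E → ℝ ∪ {+∞}` (an `EReal`-valued function that never takes the value `-∞`) that is
closed (lower semicontinuous), proper and convex. -/
structure ClosedProperConvex {E : Type*} [AddCommGroup E] [Module ℝ E] [TopologicalSpace E]
    (f : E → EReal) : Prop where
  ne_bot : ∀ x, f x ≠ ⊥
  exists_ne_top : ∃ x, f x ≠ ⊤
  closed : LowerSemicontinuous f
  convex : ∀ x y : E, ∀ a b : ℝ, 0 < a → 0 < b → a + b = 1 →
    f (a • x + b • y) ≤ (a : EReal) * f x + (b : EReal) * f y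

/-- Strong convexity of an extended-valued function `g` of the vector `(x_l)_{l ∈ U}`; here `g` is
written as a function on `ℝⁿ` that only looks at the components in `U`, and the Euclidean norm is
that of the components in `U`. -/
def StronglyConvexIn {n : ℕ} (U : Finset (Fin n)) (g : (Fin n → ℝ) → EReal) : Prop :=
  ∃ σ : ℝ, 0 < σ ∧ ∀ x y : Fin n → ℝ, ∀ a b : ℝ, 0 < a → 0 < b → a + b = 1 →
    g (a • x + b • y) + ((σ / 2 * a * b * ∑ l ∈ U, (x l - y l) ^ 2 : ℝ) : EReal)
      ≤ (a : EReal) * g x + (b : EReal) * g y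

section Problem

variable {P n : ℕ} (S : Fin P → Finset (Fin n))

/-- `x_T`: the components of `x` with index in `T`. -/
def restr (T : Finset (Fin n)) (x : Fin n → ℝ) : T → ℝ := fun l => x l

/-- A family of copies `x^{(p)}_{S_p}`, one vector for each node. -/
abbrev Copies : Type := ∀ p : Fin P, S p → ℝ

/-- `V_l`: the nodes whose functions depend on the component `l`. -/
def nodesOf (l : Fin n) : Set (Fin P) := {p | l ∈ S p}

/-- The variable is connected: every component induces a connected subgraph of the network. -/
def VariableConnected (G : SimpleGraph (Fin P)) : Prop :=
  ∀ l, (G.induce (nodesOf S l)).Connected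

variable {S}

/-- The copy `x_l^{(p)}`; the value for `l ∉ S_p` is never used below. -/
def Copies.at (x : Copies S) (p : Fin P) (l : Fin n) : ℝ :=
  if h : l ∈ S p then x p ⟨l, h⟩ else 0

variable (f : ∀ p : Fin P, (S p → ℝ) → EReal)

/-- The objective `f_1(x_{S_1}) + ⋯ + f_P(x_{S_P})`. -/
noncomputable def objective (x : Fin n → ℝ) : EReal := ∑ p, f p (restr (S p) x)

/-- `x` solves the problem of minimizing `f_1(x_{S_1}) + ⋯ + f_P(x_{S_P})` over `ℝⁿ`. -/
def IsSolution (x : Fin n → ℝ) : Prop :=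
  objective f x ≠ ⊤ ∧ ∀ y, objective f x ≤ objective f y

variable (G : SimpleGraph (Fin P))

open scoped Classical in
/-- The Lagrangian of the problem of minimizing `∑ p, f_p(x^{(p)}_{S_p})` over all copies subject to
`x_l^{(i)} = x_l^{(j)}` for all components `l` and all edges `(i,j)`, `i < j`, of the subgraph
induced by `l`. -/
noncomputable def lagrangian (x : Copies S) (lam : Fin n → Fin P → Fin P → ℝ) : EReal :=
  ∑ p, f p (x p) +
    ((∑ l, ∑ i, ∑ j, if i < j ∧ G.Adj i j ∧ l ∈ S i ∧ l ∈ S j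
        then lam l i j * (x.at i l - x.at j l) else 0 : ℝ) : EReal)

/-- `(x, lam)` is a primal-dual solution of the problem in `lagrangian`: `x` is feasible and
minimizes the Lagrangian with multipliers `lam`. -/
def IsPrimalDualSolution (x : Copies S) (lam : Fin n → Fin P → Fin P → ℝ) : Prop :=
  (∀ l i j, G.Adj i j → l ∈ S i → l ∈ S j → x.at i l = x.at j l) ∧
    ∀ y : Copies S, lagrangian f G x lam ≤ lagrangian f G y lam

variable (S)

open scoped Classical in
/-- `N_p ∩ V_l`: the neighbors of node `p` that depend on component `l`. -/
noncomputable def nbrs (p : Fin P) (l : Fin n) : Finset (Fin P) :=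
  Finset.univ.filter fun j => G.Adj p j ∧ l ∈ S j

variable {S}
variable {C : ℕ} (col : G.Coloring (Fin C)) (ρ : ℝ)

/-- The vector `v^{(p),k}`, computed from `γ^k`, from the new copies `x^{k+1}` at the neighbors of
smaller color and the old copies `x^k` at the neighbors of larger color. -/
noncomputable def vVec (γ x xnew : Copies S) (p : Fin P) (l : S p) : ℝ :=
  γ p l - ρ * (∑ j ∈ (nbrs S G p l).filter (fun j => col j < col p), xnew.at j l)
    - ρ * (∑ j ∈ (nbrs S G p l).filter (fun j => col p < col j), x.at j l)

/-- The objective of the problem solved by node `p`; the cardinality is the degree `D_{p,l}` of `p`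
in the subgraph induced by component `l`. -/
noncomputable def localObjective (p : Fin P) (v : S p → ℝ) (y : S p → ℝ) : EReal :=
  f p y +
    ((∑ l, v l * y l + ρ / 2 * ∑ l : S p, ((nbrs S G p l).card : ℝ) * y l ^ 2 : ℝ) : EReal)

/-- `(x^k, γ^k)` is a sequence produced by the algorithm with parameter `ρ`. The first iterate
has index `0`. -/
structure IsRun (x γ : ℕ → Copies S) : Prop where
  init_x : x 0 = 0
  init_γ : γ 0 = 0
  step_x : ∀ k p y,
    localObjective f G ρ p (vVec G col ρ (γ k) (x k) (x (k + 1)) p) (x (k + 1) p) ≤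
      localObjective f G ρ p (vVec G col ρ (γ k) (x k) (x (k + 1)) p) y
  step_γ : ∀ k p (l : S p),
    γ (k + 1) p l =
      γ k p l + ρ * ∑ j ∈ nbrs S G p l, (x (k + 1) p l - (x (k + 1)).at j l)

variable {G}

/-- The condition that the sum of the `f_p(x_{S_p})` over the nodes `p` of color `c` is a strongly
convex function of the components on which it depends. -/
def ColorSumStronglyConvex (c : Fin C) : Prop :=
  StronglyConvexIn ((Finset.univ.filter fun p => col p = c).biUnion S)
    (fun x => ∑ p ∈ Finset.univ.filter (fun p => col p = c), f p (restr (S p) x))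

end Problem

end PartialADMM

/-!
Every constraint of the reformulated problem couples only two copies. After orienting the edges by
the colors, the iteration is therefore nonexpansive for an energy that is summed over the oriented
edges, for any proper coloring and any `ρ > 0`; limit points are fixed points by a backward
induction on the colors. Neither bipartiteness nor strong convexity is needed.
-/

namespace PartialADMM

open Filter Topology

/-! ### Subgradients, and minimizers of a convex function plus a diagonal quadratic. -/

section ConvexAnalysis

variable {ι : Type*} {f : (ι → ℝ) → EReal}

/-! For each component, give every edge a multiplier, oriented from the smaller to the larger color;
the node variables γ are signed sums of these (`IsRun.exists_isOrbit`). On an arc from i to j, the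
tail i sees the old copy at j and the head j sees the new copy at i, as in two-block ADMM. Summing
the monotonicity of the subdifferentials over the nodes and regrouping by arcs yields
`IsOrbit.energy_succ_add_le`: the energy between two orbits, built from multipliers and head copies
only, drops by at least ρ times the squared differences of the residuals x_i^{k+1} - x_j^k.

A primal-dual solution is a constant orbit (`IsPrimalDualSolution.exists_isFixed`), so the energy
relative to it converges. Restart the iteration at a limit point of the orbit: along the new orbit
this energy is constant, hence all residuals vanish and tail copies repeat head copies one step
later. Nodes of the largest color then become stationary by monotonicity, and the delay spreads
stationarity to smaller colors (`IsOrbit.eventually_const`). The fixed point so reached has energy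
distance tending to zero from a subsequence of the original orbit; as this distance is antitone, the
whole orbit converges (`IsOrbit.exists_tendsto`). By `IsFixed.exists_isSolution` the limit solves
the original problem. -/

theorem ClosedProperConvex.exists_coe (hf : ClosedProperConvex f) {x : ι → ℝ} (hx : f x ≠ ⊤) :
    ∃ a : ℝ, f x = a :=
  ⟨(f x).toReal, (EReal.coe_toReal hx (hf.ne_bot x)).symm⟩

theorem ClosedProperConvex.le_coe (hf : ClosedProperConvex f) {x y : ι → ℝ} {u v : ℝ}
    (hx : f x = u) (hy : f y = v) {a b : ℝ} (ha : 0 < a) (hb : 0 < b) (hab : a + b = 1) :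
    f (a • x + b • y) ≤ ((a * u + b * v : ℝ) : EReal) := by
  have h := hf.convex x y a b ha hb hab
  rw [hx, hy] at h
  exact_mod_cast h

variable [Fintype ι]

/-- `g` is a subgradient at `x` of the extended-valued function `f`, which is finite at `x`. -/
def IsSubgradient (f : (ι → ℝ) → EReal) (x g : ι → ℝ) : Prop :=
  f x ≠ ⊤ ∧ ∀ y, f x + ((∑ i, g i * (y i - x i) : ℝ) : EReal) ≤ f y

/-- The subdifferential is monotone. -/
theorem IsSubgradient.monotone (hf : ClosedProperConvex f) {x y g h : ι → ℝ}
    (hx : IsSubgradient f x g) (hy : IsSubgradient f y h) :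
    0 ≤ ∑ i, (g i - h i) * (x i - y i) := by
  obtain ⟨u, hu⟩ := hf.exists_coe hx.1
  obtain ⟨v, hv⟩ := hf.exists_coe hy.1
  have h1 := hx.2 y
  have h2 := hy.2 x
  rw [hu, hv] at h1 h2
  have h1' : u + ∑ i, g i * (y i - x i) ≤ v := by exact_mod_cast h1
  have h2' : v + ∑ i, h i * (x i - y i) ≤ u := by exact_mod_cast h2
  have e : ∑ i, (g i - h i) * (x i - y i)
      = -(∑ i, g i * (y i - x i)) - ∑ i, h i * (x i - y i) := by
    rw [← Finset.sum_neg_distrib, ← Finset.sum_sub_distrib]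
    exact Finset.sum_congr rfl fun i _ => by ring
  linarith

/-- Fermat's rule for the sum of a convex function and a separable quadratic one. -/
theorem isSubgradient_of_minimizer (hf : ClosedProperConvex f) (v D : ι → ℝ) (ρ : ℝ) {y : ι → ℝ}
    (hy : ∀ z, f y + ((∑ i, v i * y i + ρ / 2 * ∑ i, D i * y i ^ 2 : ℝ) : EReal)
      ≤ f z + ((∑ i, v i * z i + ρ / 2 * ∑ i, D i * z i ^ 2 : ℝ) : EReal)) :
    IsSubgradient f y (fun i => -(v i + ρ * D i * y i)) := by
  have hfin : f y ≠ ⊤ := by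
    obtain ⟨x₀, hx₀⟩ := hf.exists_ne_top
    obtain ⟨u, hu⟩ := hf.exists_coe hx₀
    intro htop
    have := hy x₀
    rw [htop, hu, EReal.top_add_coe, ← EReal.coe_add] at this
    exact absurd (top_le_iff.1 this) (EReal.coe_ne_top _)
  refine ⟨hfin, fun z => ?_⟩
  by_cases hz : f z = ⊤
  · rw [hz]; exact le_top
  obtain ⟨u, hu⟩ := hf.exists_coe hfin
  obtain ⟨w, hw⟩ := hf.exists_coe hz
  rw [hu, hw]
  set A := ∑ i, (v i + ρ * D i * y i) * (z i - y i) with hA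
  set B := ρ / 2 * ∑ i, D i * (z i - y i) ^ 2 with hB
  -- Compare `y` with a point of the segment towards `z`: the quadratic part changes by `t * A + t ^
  -- 2 * B`. Divide by `t`, then let `t` tend to 0.
  have key : ∀ t : ℝ, 0 < t → t < 1 → u ≤ w + A + t * B := by
    intro t ht ht1
    have h1 := hy ((1 - t) • y + t • z)
    have h2 := hf.le_coe hu hw (sub_pos.2 ht1) ht (by ring)
    rw [hu] at h1
    have h3 := h1.trans (add_le_add_left h2 _)
    have h4 : u + (∑ i, v i * y i + ρ / 2 * ∑ i, D i * y i ^ 2) ≤ ((1 - t) * u + t * w) +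
        (∑ i, v i * ((1 - t) • y + t • z) i
          + ρ / 2 * ∑ i, D i * ((1 - t) • y + t • z) i ^ 2) := by exact_mod_cast h3
    have e : (∑ i, v i * ((1 - t) • y + t • z) i
          + ρ / 2 * ∑ i, D i * ((1 - t) • y + t • z) i ^ 2)
        = (∑ i, v i * y i + ρ / 2 * ∑ i, D i * y i ^ 2) + t * A + t ^ 2 * B := by
      simp only [hA, hB, Finset.mul_sum, ← Finset.sum_add_distrib, Pi.add_apply, Pi.smul_apply,
        smul_eq_mul]
      exact Finset.sum_congr rfl fun i _ => by ring
    rw [e] at h4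
    have h5 : t * u ≤ t * (w + A + t * B) := by nlinarith
    exact le_of_mul_le_mul_left h5 ht
  have lim : Tendsto (fun t : ℝ => w + A + t * B) (𝓝[>] 0) (𝓝 (w + A + 0 * B)) :=
    ((by fun_prop : Continuous fun t : ℝ => w + A + t * B).tendsto 0).mono_left
      nhdsWithin_le_nhds
  have h6 : u ≤ w + A + 0 * B := by
    refine ge_of_tendsto lim ?_
    filter_upwards [Ioo_mem_nhdsGT (zero_lt_one' ℝ)] with t ht
    exact key t ht.1 ht.2
  have e : ∑ i, -(v i + ρ * D i * y i) * (z i - y i) = -A := by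
    simp only [hA, neg_mul, Finset.sum_neg_distrib]
  rw [e]
  have : u + -A ≤ w := by linarith
  exact_mod_cast this

/-- A closed proper convex function has an affine minorant in terms of the norm. -/
theorem ClosedProperConvex.exists_lower_bound (hf : ClosedProperConvex f) :
    ∃ A B : ℝ, 0 ≤ A ∧ ∀ y, ((-(A * ‖y‖ + B) : ℝ) : EReal) ≤ f y := by
  obtain ⟨x₀, hx₀⟩ := hf.exists_ne_top
  obtain ⟨u, hu⟩ := hf.exists_coe hx₀
  obtain ⟨a, ha, hmin⟩ := LowerSemicontinuousOn.exists_isMinOn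
    (⟨x₀, Metric.mem_closedBall_self zero_le_one⟩ : (Metric.closedBall x₀ 1).Nonempty)
    (isCompact_closedBall x₀ 1) (hf.closed.lowerSemicontinuousOn _)
  have hau : f a ≤ f x₀ := hmin (Metric.mem_closedBall_self zero_le_one)
  obtain ⟨m, hm⟩ := hf.exists_coe (x := a) (by
    intro h; rw [h, hu] at hau; exact absurd (top_le_iff.1 hau) (EReal.coe_ne_top _))
  have hmu : m ≤ u := by rw [hm, hu] at hau; exact_mod_cast hau
  refine ⟨u - m, (u - m) * ‖x₀‖ - m, by linarith, fun y => ?_⟩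
  by_cases hy : f y = ⊤
  · rw [hy]; exact le_top
  obtain ⟨w, hw⟩ := hf.exists_coe hy
  rw [hw, EReal.coe_le_coe_iff]
  have htri : ‖y - x₀‖ ≤ ‖y‖ + ‖x₀‖ := norm_sub_le _ _
  have hbd : m - (u - m) * ‖y - x₀‖ ≤ w := by
    rcases le_or_gt ‖y - x₀‖ 1 with hr | hr
    · have h1 : f a ≤ f y := hmin (by simpa [dist_eq_norm] using hr)
      rw [hm, hw, EReal.coe_le_coe_iff] at h1
      have := mul_nonneg (sub_nonneg.2 hmu) (norm_nonneg (y - x₀))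
      linarith
    · set r := ‖y - x₀‖ with hrdef
      have hr0 : 0 < r := by linarith
      have hinv : r⁻¹ < 1 := inv_lt_one_of_one_lt₀ hr
      -- The convex combination lies at distance exactly 1 from `x₀`, where `f` is at least `m`.
      have h1 := hf.le_coe hu hw (a := 1 - r⁻¹) (b := r⁻¹) (by linarith) (by positivity) (by ring)
      have h2 : f a ≤ f ((1 - r⁻¹) • x₀ + r⁻¹ • y) := by
        apply hmin
        have : (1 - r⁻¹) • x₀ + r⁻¹ • y - x₀ = r⁻¹ • (y - x₀) := by module
        rw [Metric.mem_closedBall, dist_eq_norm, this, norm_smul, ← hrdef,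
          norm_inv, Real.norm_of_nonneg hr0.le, inv_mul_cancel₀ hr0.ne']
      have h3 := h2.trans h1
      rw [hm, EReal.coe_le_coe_iff] at h3
      have h4 : r * m ≤ r * ((1 - r⁻¹) * u + r⁻¹ * w) := mul_le_mul_of_nonneg_left h3 hr0.le
      have h5 : r * ((1 - r⁻¹) * u + r⁻¹ * w) = (r - 1) * u + w := by field_simp
      rw [h5] at h4
      nlinarith
  have := mul_le_mul_of_nonneg_left htri (sub_nonneg.2 hmu)
  linarith

/-- The quadratic term, coercive because every `D i` is at least 1, beats the affine minorant of
`f`; lower semicontinuity on a large ball does the rest. -/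
theorem ClosedProperConvex.exists_minimizer (hf : ClosedProperConvex f) (v D : ι → ℝ) {ρ : ℝ}
    (hρ : 0 < ρ) (hD : ∀ i, 1 ≤ D i) :
    ∃ y, ∀ z, f y + ((∑ i, v i * y i + ρ / 2 * ∑ i, D i * y i ^ 2 : ℝ) : EReal)
      ≤ f z + ((∑ i, v i * z i + ρ / 2 * ∑ i, D i * z i ^ 2 : ℝ) : EReal) := by
  set q : (ι → ℝ) → ℝ := fun y => ∑ i, v i * y i + ρ / 2 * ∑ i, D i * y i ^ 2 with hq
  have hqc : Continuous q := by fun_prop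
  have hlsc : LowerSemicontinuous fun y => f y + (q y : EReal) :=
    hf.closed.add' (continuous_coe_real_ereal.comp hqc).lowerSemicontinuous fun x =>
      EReal.continuousAt_add (Or.inr (EReal.coe_ne_bot _)) (Or.inr (EReal.coe_ne_top _))
  obtain ⟨A, B, hA, hAB⟩ := hf.exists_lower_bound
  obtain ⟨x₀, hx₀⟩ := hf.exists_ne_top
  obtain ⟨u, hu⟩ := hf.exists_coe hx₀
  set W := ∑ i, |v i| with hW
  have hqlow : ∀ y, ρ / 2 * ‖y‖ ^ 2 - W * ‖y‖ ≤ q y := by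
    intro y
    have h1 : -(W * ‖y‖) ≤ ∑ i, v i * y i := by
      rw [hW, Finset.sum_mul, ← Finset.sum_neg_distrib]
      refine Finset.sum_le_sum fun i _ => ?_
      have h := neg_abs_le (v i * y i)
      rw [abs_mul] at h
      have h' := mul_le_mul_of_nonneg_left (norm_le_pi_norm y i) (abs_nonneg (v i))
      rw [Real.norm_eq_abs] at h'
      linarith
    have hsum : ∀ i, y i ^ 2 ≤ ∑ i, D i * y i ^ 2 := fun i => by
      have h1 : D i * y i ^ 2 ≤ ∑ i, D i * y i ^ 2 :=
        Finset.single_le_sum (f := fun i => D i * y i ^ 2)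
          (fun j _ => mul_nonneg (zero_le_one.trans (hD j)) (sq_nonneg _)) (Finset.mem_univ i)
      nlinarith [hD i, sq_nonneg (y i)]
    have h0 : 0 ≤ ∑ i, D i * y i ^ 2 :=
      Finset.sum_nonneg fun j _ => mul_nonneg (zero_le_one.trans (hD j)) (sq_nonneg _)
    have h2 : ‖y‖ ^ 2 ≤ ∑ i, D i * y i ^ 2 := by
      have : ‖y‖ ≤ √(∑ i, D i * y i ^ 2) :=
        (pi_norm_le_iff_of_nonneg (Real.sqrt_nonneg _)).2 fun i => Real.abs_le_sqrt (hsum i)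
      calc ‖y‖ ^ 2 ≤ √(∑ i, D i * y i ^ 2) ^ 2 := by gcongr
        _ = _ := Real.sq_sqrt h0
    have h3 := mul_le_mul_of_nonneg_left h2 (half_pos hρ).le
    simp only [hq]
    linarith
  set c := u + q x₀ with hc
  -- Chosen so that `ρ / 2 * ‖y‖ - (A + W) ≥ |B| + |c|` once `‖y‖ ≥ R`; as also `‖y‖ ≥ 1`, the value
  -- at `y` is then at least the value `c` at `x₀`.
  set R := 1 + 2 / ρ * (A + W + |B| + |c|) with hR
  have hW0 : 0 ≤ W := Finset.sum_nonneg fun i _ => abs_nonneg _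
  have hR1 : 1 ≤ R := by
    have : 0 ≤ 2 / ρ * (A + W + |B| + |c|) := by positivity
    linarith
  have hfar : ∀ y, R ≤ ‖y‖ → f x₀ + (q x₀ : EReal) ≤ f y + (q y : EReal) := by
    intro y hy
    have h1 : ((-(A * ‖y‖ + B) + q y : ℝ) : EReal) ≤ f y + (q y : EReal) := by
      rw [EReal.coe_add]; exact add_le_add_left (hAB y) _
    refine le_trans ?_ h1
    rw [hu, ← EReal.coe_add, EReal.coe_le_coe_iff]
    have h2 := hqlow y
    have h3 : ρ / 2 * R = ρ / 2 + (A + W + |B| + |c|) := by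
      rw [hR]; field_simp
    have h4 : ρ / 2 * R ≤ ρ / 2 * ‖y‖ := mul_le_mul_of_nonneg_left hy (half_pos hρ).le
    have h5 : |B| + |c| ≤ ρ / 2 * ‖y‖ - (A + W) := by linarith
    have h6 : |B| + |c| ≤ ‖y‖ * (ρ / 2 * ‖y‖ - (A + W)) := by
      have hp : 0 ≤ |B| + |c| := by positivity
      nlinarith
    have h7 := le_abs_self B
    have h8 := le_abs_self c
    nlinarith
  obtain ⟨y, -, hmin⟩ := LowerSemicontinuousOn.exists_isMinOn
    (⟨x₀, by simp⟩ : (Metric.closedBall (0 : ι → ℝ) (max R ‖x₀‖)).Nonempty)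
    (isCompact_closedBall _ _) (hlsc.lowerSemicontinuousOn _)
  refine ⟨y, fun z => ?_⟩
  rcases le_or_gt ‖z‖ (max R ‖x₀‖) with hz | hz
  · exact hmin (by simpa using hz)
  · exact (hmin (by simp : x₀ ∈ Metric.closedBall (0 : ι → ℝ) (max R ‖x₀‖))).trans
      (hfar z ((le_max_left _ _).trans hz.le))

end ConvexAnalysis

/-! ### Edge multipliers and the nonexpansive energy. -/

section Orbits

variable {P n C : ℕ} {S : Fin P → Finset (Fin n)} {f : ∀ p : Fin P, (S p → ℝ) → EReal}
  {G : SimpleGraph (Fin P)} {col : G.Coloring (Fin C)} {ρ : ℝ}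

theorem Copies.at_coe (x : Copies S) {p : Fin P} (l : S p) : x.at p l = x p l := by
  simp [Copies.at]

theorem mem_nbrs {p j : Fin P} {l : Fin n} : j ∈ nbrs S G p l ↔ G.Adj p j ∧ l ∈ S j := by
  simp [nbrs]

open scoped Classical in
/-- The triples `(l, i, j)` where `{i, j}` is an edge of the subgraph induced by the component `l`,
oriented from the smaller to the larger color. -/
noncomputable def arcs (S : Fin P → Finset (Fin n)) (col : G.Coloring (Fin C)) :
    Finset (Fin n × Fin P × Fin P) :=
  Finset.univ.filter fun e =>
    G.Adj e.2.1 e.2.2 ∧ e.1 ∈ S e.2.1 ∧ e.1 ∈ S e.2.2 ∧ col e.2.1 < col e.2.2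

theorem mem_arcs {l : Fin n} {i j : Fin P} :
    (l, i, j) ∈ arcs S col ↔ G.Adj i j ∧ l ∈ S i ∧ l ∈ S j ∧ col i < col j := by
  simp [arcs]

theorem mem_arcs_or {l : Fin n} {i j : Fin P} (h : G.Adj i j) (hi : l ∈ S i) (hj : l ∈ S j) :
    (l, i, j) ∈ arcs S col ∨ (l, j, i) ∈ arcs S col := by
  rcases lt_or_gt_of_ne (col.valid h) with hlt | hlt
  · exact Or.inl (mem_arcs.2 ⟨h, hi, hj, hlt⟩)
  · exact Or.inr (mem_arcs.2 ⟨h.symm, hj, hi, hlt⟩)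

open scoped Classical in
theorem sum_nbrs_eq_sum_ite (F : Fin n → Fin P → Fin P → ℝ) :
    ∑ p, ∑ l : S p, ∑ j ∈ nbrs S G p l, F l p j
      = ∑ l, ∑ p, ∑ j, if l ∈ S p ∧ G.Adj p j ∧ l ∈ S j then F l p j else 0 := by
  rw [Finset.sum_comm (s := Finset.univ (α := Fin n))]
  refine Finset.sum_congr rfl fun p _ => ?_
  rw [Finset.sum_coe_sort (S p) (fun l => ∑ j ∈ nbrs S G p l, F l p j),
    ← Finset.univ_inter (S p), ← Finset.sum_ite_mem]
  refine Finset.sum_congr rfl fun l _ => ?_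
  by_cases hl : l ∈ S p <;> simp [hl, nbrs, Finset.sum_filter]

/-- A sum over all the pairs of neighboring copies, grouped by edges. -/
theorem sum_nbrs_eq_sum_arcs (col : G.Coloring (Fin C)) (F : Fin n → Fin P → Fin P → ℝ) :
    ∑ p, ∑ l : S p, ∑ j ∈ nbrs S G p l, F l p j
      = ∑ e ∈ arcs S col, (F e.1 e.2.1 e.2.2 + F e.1 e.2.2 e.2.1) := by
  classical
  have h : ∑ e ∈ arcs S col, (F e.1 e.2.1 e.2.2 + F e.1 e.2.2 e.2.1)
      = ∑ l, ((∑ i, ∑ j, if l ∈ S i ∧ G.Adj i j ∧ l ∈ S j ∧ col i < col j then F l i j else 0)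
        + ∑ i, ∑ j, if l ∈ S i ∧ G.Adj i j ∧ l ∈ S j ∧ col i < col j then F l j i else 0) := by
    rw [arcs, Finset.sum_filter, Fintype.sum_prod_type]
    refine Finset.sum_congr rfl fun l _ => ?_
    rw [Fintype.sum_prod_type]
    simp only [← Finset.sum_add_distrib]
    refine Finset.sum_congr rfl fun i _ => Finset.sum_congr rfl fun j _ => ?_
    by_cases h : l ∈ S i ∧ G.Adj i j ∧ l ∈ S j ∧ col i < col j
    · rw [if_pos (by tauto), if_pos h, if_pos h]
    · rw [if_neg (by tauto), if_neg h, if_neg h, add_zero]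
  rw [sum_nbrs_eq_sum_ite, h]
  refine Finset.sum_congr rfl fun l _ => ?_
  rw [Finset.sum_comm
    (f := fun i j => if l ∈ S i ∧ G.Adj i j ∧ l ∈ S j ∧ col i < col j then F l j i else 0)]
  simp only [← Finset.sum_add_distrib]
  refine Finset.sum_congr rfl fun i _ => Finset.sum_congr rfl fun j _ => ?_
  by_cases h : l ∈ S i ∧ G.Adj i j ∧ l ∈ S j
  · obtain ⟨hi, hij, hj⟩ := h
    rcases lt_or_gt_of_ne (col.valid hij) with hlt | hlt
    · simp [hi, hij, hj, hlt, hlt.not_gt]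
    · simp [hi, hij, hij.symm, hj, hlt, hlt.not_gt]
  · rw [if_neg h, if_neg (by tauto), if_neg (by rw [G.adj_comm]; tauto), add_zero]

/-- The force that the edge to the neighbor `j` exerts on the component `l` of the copy at `p`, where
`x` and `x'` are the old and the new copies and `lam` the new multipliers. -/
noncomputable def edgeForce (col : G.Coloring (Fin C)) (ρ : ℝ) (lam : Fin n → Fin P → Fin P → ℝ)
    (x x' : Copies S) (l : Fin n) (p j : Fin P) : ℝ :=
  if col p < col j then lam l p j + ρ * (x'.at j l - x.at j l) else -lam l j p

/-- The iteration of the algorithm in terms of multipliers of the oriented edges, from arbitrary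
starting points. -/
structure IsOrbit (f : ∀ p : Fin P, (S p → ℝ) → EReal) (col : G.Coloring (Fin C)) (ρ : ℝ)
    (x : ℕ → Copies S) (lam : ℕ → Fin n → Fin P → Fin P → ℝ) : Prop where
  subgradient : ∀ k p, IsSubgradient (f p) (x (k + 1) p) fun l =>
    -∑ j ∈ nbrs S G p l, edgeForce col ρ (lam (k + 1)) (x k) (x (k + 1)) l p j
  multiplier : ∀ k l i j, (l, i, j) ∈ arcs S col →
    lam (k + 1) l i j = lam k l i j + ρ * ((x (k + 1)).at i l - (x (k + 1)).at j l)

/-- The squared distance of two states of the iteration. -/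
noncomputable def energy (col : G.Coloring (Fin C)) (ρ : ℝ) (x y : Copies S)
    (lam mu : Fin n → Fin P → Fin P → ℝ) : ℝ :=
  ∑ e ∈ arcs S col, ((lam e.1 e.2.1 e.2.2 - mu e.1 e.2.1 e.2.2) ^ 2 / ρ
    + ρ * (x.at e.2.2 e.1 - y.at e.2.2 e.1) ^ 2)

/-- The iteration is nonexpansive. -/
theorem IsOrbit.energy_succ_add_le (hρ : 0 < ρ) (hf : ∀ p, ClosedProperConvex (f p))
    {x y : ℕ → Copies S} {lam mu : ℕ → Fin n → Fin P → Fin P → ℝ}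
    (hx : IsOrbit f col ρ x lam) (hy : IsOrbit f col ρ y mu) (k : ℕ) :
    energy col ρ (x (k + 1)) (y (k + 1)) (lam (k + 1)) (mu (k + 1))
      + ∑ e ∈ arcs S col, ρ * (((x (k + 1)).at e.2.1 e.1 - (x k).at e.2.2 e.1)
        - ((y (k + 1)).at e.2.1 e.1 - (y k).at e.2.2 e.1)) ^ 2
      ≤ energy col ρ (x k) (y k) (lam k) (mu k) := by
  have hmono : 0 ≤ ∑ p, ∑ l : S p,
      (-∑ j ∈ nbrs S G p l, edgeForce col ρ (lam (k + 1)) (x k) (x (k + 1)) l p j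
        - -∑ j ∈ nbrs S G p l, edgeForce col ρ (mu (k + 1)) (y k) (y (k + 1)) l p j)
      * (x (k + 1) p l - y (k + 1) p l) :=
    Finset.sum_nonneg fun p _ => (hx.subgradient k p).monotone (hf p) (hy.subgradient k p)
  set F : Fin n → Fin P → Fin P → ℝ := fun l p j =>
    (edgeForce col ρ (mu (k + 1)) (y k) (y (k + 1)) l p j
      - edgeForce col ρ (lam (k + 1)) (x k) (x (k + 1)) l p j)
      * ((x (k + 1)).at p l - (y (k + 1)).at p l) with hF
  have e1 : ∑ p, ∑ l : S p,
      (-∑ j ∈ nbrs S G p l, edgeForce col ρ (lam (k + 1)) (x k) (x (k + 1)) l p j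
        - -∑ j ∈ nbrs S G p l, edgeForce col ρ (mu (k + 1)) (y k) (y (k + 1)) l p j)
      * (x (k + 1) p l - y (k + 1) p l) = ∑ p, ∑ l : S p, ∑ j ∈ nbrs S G p l, F l p j := by
    refine Finset.sum_congr rfl fun p _ => Finset.sum_congr rfl fun l _ => ?_
    simp only [hF]
    rw [← Finset.sum_mul, Finset.sum_sub_distrib, Copies.at_coe, Copies.at_coe]
    ring
  rw [e1, sum_nbrs_eq_sum_arcs col] at hmono
  -- The energy inequality loses nothing but monotonicity: its defect is exactly twice the
  -- monotonicity sum, by an identity on each arc.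
  suffices h : energy col ρ (x k) (y k) (lam k) (mu k)
      - energy col ρ (x (k + 1)) (y (k + 1)) (lam (k + 1)) (mu (k + 1))
      - ∑ e ∈ arcs S col, ρ * (((x (k + 1)).at e.2.1 e.1 - (x k).at e.2.2 e.1)
        - ((y (k + 1)).at e.2.1 e.1 - (y k).at e.2.2 e.1)) ^ 2
      = 2 * ∑ e ∈ arcs S col, (F e.1 e.2.1 e.2.2 + F e.1 e.2.2 e.2.1) by linarith
  rw [energy, energy, ← Finset.sum_sub_distrib, ← Finset.sum_sub_distrib, Finset.mul_sum]
  refine Finset.sum_congr rfl fun ⟨l, i, j⟩ he => ?_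
  have hlt := (mem_arcs.1 he).2.2.2
  simp only [hF, edgeForce, if_pos hlt, if_neg hlt.not_gt, hx.multiplier k l i j he,
    hy.multiplier k l i j he]
  field_simp
  ring

theorem energy_nonneg (hρ : 0 < ρ) (x y : Copies S) (lam mu : Fin n → Fin P → Fin P → ℝ) :
    0 ≤ energy col ρ x y lam mu :=
  Finset.sum_nonneg fun _ _ => by positivity

theorem IsOrbit.antitone_energy (hρ : 0 < ρ) (hf : ∀ p, ClosedProperConvex (f p))
    {x y : ℕ → Copies S} {lam mu : ℕ → Fin n → Fin P → Fin P → ℝ}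
    (hx : IsOrbit f col ρ x lam) (hy : IsOrbit f col ρ y mu) :
    Antitone fun k => energy col ρ (x k) (y k) (lam k) (mu k) :=
  antitone_nat_of_succ_le fun k => (le_add_of_nonneg_right
    (Finset.sum_nonneg fun _ _ => by positivity)).trans (hx.energy_succ_add_le hρ hf hy k)

theorem sq_multiplier_sub_le_energy (hρ : 0 < ρ) (x y : Copies S)
    (lam mu : Fin n → Fin P → Fin P → ℝ) {l : Fin n} {i j : Fin P} (he : (l, i, j) ∈ arcs S col) :
    (lam l i j - mu l i j) ^ 2 ≤ ρ * energy col ρ x y lam mu := by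
  have h := Finset.single_le_sum (f := fun e : Fin n × Fin P × Fin P =>
    ((lam e.1 e.2.1 e.2.2 - mu e.1 e.2.1 e.2.2) ^ 2 / ρ
      + ρ * (x.at e.2.2 e.1 - y.at e.2.2 e.1) ^ 2)) (fun _ _ => by positivity) he
  have h' : (lam l i j - mu l i j) ^ 2 / ρ ≤ energy col ρ x y lam mu :=
    (le_add_of_nonneg_right (by positivity)).trans h
  rwa [div_le_iff₀' hρ] at h'

theorem sq_at_sub_le_energy (hρ : 0 < ρ) (x y : Copies S)
    (lam mu : Fin n → Fin P → Fin P → ℝ) {l : Fin n} {i j : Fin P} (he : (l, i, j) ∈ arcs S col) :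
    (x.at j l - y.at j l) ^ 2 ≤ energy col ρ x y lam mu / ρ := by
  have h := Finset.single_le_sum (f := fun e : Fin n × Fin P × Fin P =>
    ((lam e.1 e.2.1 e.2.2 - mu e.1 e.2.1 e.2.2) ^ 2 / ρ
      + ρ * (x.at e.2.2 e.1 - y.at e.2.2 e.1) ^ 2)) (fun _ _ => by positivity) he
  rw [le_div_iff₀' hρ]
  exact (le_add_of_nonneg_left (by positivity)).trans h

theorem IsOrbit.sq_at_sub_le (hρ : 0 < ρ) (hf : ∀ p, ClosedProperConvex (f p))
    {x y : ℕ → Copies S} {lam mu : ℕ → Fin n → Fin P → Fin P → ℝ}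
    (hx : IsOrbit f col ρ x lam) (hy : IsOrbit f col ρ y mu) (k : ℕ) {l : Fin n} {i j : Fin P}
    (he : (l, i, j) ∈ arcs S col) :
    (((x (k + 1)).at i l - (x k).at j l) - ((y (k + 1)).at i l - (y k).at j l)) ^ 2
      ≤ (energy col ρ (x k) (y k) (lam k) (mu k)
        - energy col ρ (x (k + 1)) (y (k + 1)) (lam (k + 1)) (mu (k + 1))) / ρ := by
  have h := Finset.single_le_sum (f := fun e : Fin n × Fin P × Fin P =>
    ρ * (((x (k + 1)).at e.2.1 e.1 - (x k).at e.2.2 e.1)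
        - ((y (k + 1)).at e.2.1 e.1 - (y k).at e.2.2 e.1)) ^ 2) (fun _ _ => by positivity) he
  rw [le_div_iff₀' hρ]
  have := hx.energy_succ_add_le hρ hf hy k
  simp only at h
  linarith

end Orbits

/-! ### Limit points, fixed points and convergence of orbits. -/

section Convergence

variable {P n C : ℕ} {S : Fin P → Finset (Fin n)} {f : ∀ p : Fin P, (S p → ℝ) → EReal}
  {G : SimpleGraph (Fin P)} {col : G.Coloring (Fin C)} {ρ : ℝ}

theorem continuous_at (p : Fin P) (l : Fin n) : Continuous fun x : Copies S => x.at p l := by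
  unfold Copies.at
  split_ifs <;> fun_prop

/-- The energy sees only head copies. A tail copy at time `k + 1` is its residual plus the head copy
at time `k`, and both are controlled; `(a + b) ^ 2 ≤ 2 * a ^ 2 + 2 * b ^ 2` gives the factor 4.
Every copy lies on some arc by `hnbrs`. -/
theorem IsOrbit.sq_sub_le (hρ : 0 < ρ) (hf : ∀ p, ClosedProperConvex (f p))
    (hnbrs : ∀ p, ∀ l ∈ S p, (nbrs S G p l).Nonempty)
    {x y : ℕ → Copies S} {lam mu : ℕ → Fin n → Fin P → Fin P → ℝ}
    (hx : IsOrbit f col ρ x lam) (hy : IsOrbit f col ρ y mu) (k : ℕ) (p : Fin P) (l : S p) :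
    (x (k + 1) p l - y (k + 1) p l) ^ 2
      ≤ 4 * (energy col ρ (x k) (y k) (lam k) (mu k) / ρ) := by
  rw [← Copies.at_coe (x (k + 1)), ← Copies.at_coe (y (k + 1))]
  have hV := div_nonneg (energy_nonneg (col := col) hρ (x k) (y k) (lam k) (mu k)) hρ.le
  have hV' := div_nonneg (energy_nonneg (col := col) hρ (x (k + 1)) (y (k + 1))
    (lam (k + 1)) (mu (k + 1))) hρ.le
  obtain ⟨j, hj⟩ := hnbrs p l l.2
  rw [mem_nbrs] at hj
  rcases mem_arcs_or (col := col) hj.1 l.2 hj.2 with he | he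
  · have h1 := hx.sq_at_sub_le hρ hf hy k he
    rw [sub_div] at h1
    have h2 := sq_at_sub_le_energy hρ (x k) (y k) (lam k) (mu k) he
    nlinarith [sq_nonneg (((x (k + 1)).at p l - (x k).at j l) - ((y (k + 1)).at p l - (y k).at j l)
      - ((x k).at j l - (y k).at j l))]
  · have h1 := sq_at_sub_le_energy hρ (x (k + 1)) (y (k + 1)) (lam (k + 1)) (mu (k + 1)) he
    have h2 := div_le_div_of_nonneg_right (hx.antitone_energy hρ hf hy k.le_succ) hρ.le
    simp only [Nat.succ_eq_add_one] at h2
    linarith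

/-- The constant sequence at `(s, mu)` is an orbit, i.e. `(s, mu)` is a primal-dual solution. -/
def IsFixed (f : ∀ p : Fin P, (S p → ℝ) → EReal) (col : G.Coloring (Fin C)) (ρ : ℝ)
    (s : Copies S) (mu : Fin n → Fin P → Fin P → ℝ) : Prop :=
  IsOrbit f col ρ (fun _ => s) fun _ => mu

theorem IsFixed.at_eq_at (hρ : 0 < ρ) {s : Copies S} {mu : Fin n → Fin P → Fin P → ℝ}
    (h : IsFixed f col ρ s mu) {l : Fin n} {i j : Fin P} (he : (l, i, j) ∈ arcs S col) :
    s.at i l = s.at j l := by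
  have h1 := h.multiplier 0 l i j he
  have h2 : ρ * (s.at i l - s.at j l) = 0 := by linarith
  have := (mul_eq_zero.1 h2).resolve_left hρ.ne'
  linarith

/-- An orbit whose copies at the head of an arc repeat with a delay those at its tail has
eventually constant copies: backward induction on the colors. -/
theorem IsOrbit.eventually_const (hρ : 0 < ρ) (hf : ∀ p, ClosedProperConvex (f p))
    (hnbrs : ∀ p, ∀ l ∈ S p, (nbrs S G p l).Nonempty)
    {x : ℕ → Copies S} {lam : ℕ → Fin n → Fin P → Fin P → ℝ} (hx : IsOrbit f col ρ x lam)
    (hdelay : ∀ m l i j, (l, i, j) ∈ arcs S col → (x (m + 1)).at i l = (x m).at j l) (t : ℕ) :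
    ∀ p, C ≤ (col p : ℕ) + t → ∀ m, t ≤ m → x (m + 1) p = x m p := by
  induction t with
  | zero => exact fun p hp => absurd hp (by have := (col p).2; omega)
  | succ t ih =>
    intro p hp m hm
    obtain ⟨m, rfl⟩ : ∃ m', m = m' + 1 := ⟨m - 1, by omega⟩
    -- A component shared with a neighbor of larger color repeats, one step later, a copy that is
    -- already stationary.
    have hlater : ∀ l : S p, ∀ j ∈ nbrs S G p l, col p < col j →
        x (m + 1 + 1) p l - x (m + 1) p l = 0 := by
      intro l j hj hlt
      rw [mem_nbrs] at hj
      have he : ((l : Fin n), p, j) ∈ arcs S col := mem_arcs.2 ⟨hj.1, l.2, hj.2, hlt⟩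
      rw [← Copies.at_coe (x (m + 1 + 1)), ← Copies.at_coe (x (m + 1)), hdelay _ _ _ _ he, hdelay _ _ _ _ he]
      have := ih j (by have : (col p : ℕ) < col j := hlt; omega) m (by omega)
      simp [Copies.at, hj.2, this]
    have hmono := (hx.subgradient (m + 1) p).monotone (hf p) (hx.subgradient m p)
    -- Where all neighbors have smaller color, the delay turns each multiplier increment into `-ρ`
    -- times the increment of the copy, so monotonicity bounds a nonpositive sum of squares below by
    -- 0.
    have hterm : ∀ l : S p,
        (-∑ j ∈ nbrs S G p l,
            edgeForce col ρ (lam (m + 1 + 1)) (x (m + 1)) (x (m + 1 + 1)) l p j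
          - -∑ j ∈ nbrs S G p l, edgeForce col ρ (lam (m + 1)) (x m) (x (m + 1)) l p j)
          * (x (m + 1 + 1) p l - x (m + 1) p l)
        = -∑ j ∈ nbrs S G p l, ρ * (x (m + 1 + 1) p l - x (m + 1) p l) ^ 2 := by
      intro l
      rw [neg_sub_neg, ← neg_sub, neg_mul, ← Finset.sum_sub_distrib, Finset.sum_mul]
      congr 1
      refine Finset.sum_congr rfl fun j hj => ?_
      by_cases hlt : col p < col j
      · rw [hlater l j hj hlt]; ring
      · have hj' := mem_nbrs.1 hj
        have hlt' : col j < col p := lt_of_le_of_ne (not_lt.1 hlt) (col.valid hj'.1.symm)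
        have he : ((l : Fin n), j, p) ∈ arcs S col := mem_arcs.2 ⟨hj'.1.symm, hj'.2, l.2, hlt'⟩
        simp only [edgeForce, if_neg hlt]
        rw [hx.multiplier (m + 1) _ _ _ he, hdelay _ _ _ _ he, Copies.at_coe, Copies.at_coe]
        ring
    have hsum : ∑ l : S p, ∑ j ∈ nbrs S G p l, ρ * (x (m + 1 + 1) p l - x (m + 1) p l) ^ 2 = 0 := by
      refine le_antisymm ?_ (Finset.sum_nonneg fun l _ => Finset.sum_nonneg fun j _ => by positivity)
      rw [Finset.sum_congr rfl fun l _ => hterm l, Finset.sum_neg_distrib] at hmono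
      linarith
    funext l
    have h1 := (Finset.sum_eq_zero_iff_of_nonneg fun l _ =>
      Finset.sum_nonneg fun j _ => by positivity).1 hsum l (Finset.mem_univ l)
    obtain ⟨j, hj⟩ := hnbrs p l l.2
    have h2 := (Finset.sum_eq_zero_iff_of_nonneg fun j _ => by positivity).1 h1 j hj
    have h3 := pow_eq_zero_iff two_ne_zero |>.1 ((mul_eq_zero.1 h2).resolve_left hρ.ne')
    linarith

theorem IsOrbit.exists_isFixed (hρ : 0 < ρ) (hf : ∀ p, ClosedProperConvex (f p))
    (hnbrs : ∀ p, ∀ l ∈ S p, (nbrs S G p l).Nonempty)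
    {x : ℕ → Copies S} {lam : ℕ → Fin n → Fin P → Fin P → ℝ} (hx : IsOrbit f col ρ x lam)
    (hdelay : ∀ m l i j, (l, i, j) ∈ arcs S col → (x (m + 1)).at i l = (x m).at j l) :
    ∃ m, IsFixed f col ρ (x m) (lam m) := by
  have hconst : ∀ m, C ≤ m → x (m + 1) = x m := fun m hm => funext fun p =>
    hx.eventually_const hρ hf hnbrs hdelay C p (by omega) m hm
  -- The subgradient relation of step `C` carries the multipliers of index `C + 1`.
  refine ⟨C + 1, ⟨fun _ p => ?_, fun _ l i j he => ?_⟩⟩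
  · have h := hx.subgradient C p
    rwa [← hconst C le_rfl] at h
  · have h := hdelay (C + 1) l i j he
    rw [hconst (C + 1) (by omega)] at h
    rw [h]; ring

/-- `hexists` permits restarting at a limit point, which replaces any passage to the limit in the
subgradient relations. -/
theorem IsOrbit.exists_tendsto (hρ : 0 < ρ) (hf : ∀ p, ClosedProperConvex (f p))
    (hnbrs : ∀ p, ∀ l ∈ S p, (nbrs S G p l).Nonempty)
    (hexists : ∀ x₀ lam₀, ∃ y mu, IsOrbit f col ρ y mu ∧ y 0 = x₀ ∧ mu 0 = lam₀)
    {s : Copies S} {mu : Fin n → Fin P → Fin P → ℝ} (hs : IsFixed f col ρ s mu)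
    {x : ℕ → Copies S} {lam : ℕ → Fin n → Fin P → Fin P → ℝ} (hx : IsOrbit f col ρ x lam) :
    ∃ s' mu', IsFixed f col ρ s' mu' ∧ Tendsto x atTop (𝓝 s') := by
  classical
  set V : ℕ → ℝ := fun k => energy col ρ (x k) s (lam k) mu with hV
  have hVanti : Antitone V := hx.antitone_energy hρ hf hs
  have hVnn : ∀ k, 0 ≤ V k := fun k => energy_nonneg hρ _ _ _ _
  -- Multipliers off the arcs are unconstrained and could be unbounded; zeroing them gives
  -- compactness.
  set mask : (Fin n → Fin P → Fin P → ℝ) → Fin n → Fin P → Fin P → ℝ :=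
    fun nu l i j => if (l, i, j) ∈ arcs S col then nu l i j else 0 with hmask
  -- Shifted by one, since the tail copies at time 0 are not controlled by the energy.
  set Z : ℕ → Copies S × (Fin n → Fin P → Fin P → ℝ) :=
    fun k => (x (k + 1), mask (lam (k + 1))) with hZ
  set R := max √(4 * (V 0 / ρ)) √(ρ * V 0) with hR
  have hR0 : 0 ≤ R := (Real.sqrt_nonneg _).trans (le_max_left _ _)
  have hZb : ∀ k, Z k ∈ Metric.closedBall (s, mask mu) R := by
    intro k
    rw [Metric.mem_closedBall, Prod.dist_eq]
    refine max_le ?_ ?_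
    · refine (dist_pi_le_iff hR0).2 fun p => (dist_pi_le_iff hR0).2 fun l => ?_
      refine (Real.abs_le_sqrt ?_).trans (le_max_left _ _)
      refine (hx.sq_sub_le hρ hf hnbrs hs k p l).trans ?_
      have := div_le_div_of_nonneg_right (hVanti (Nat.zero_le k)) hρ.le
      simp only [hV] at this ⊢
      linarith
    · refine (dist_pi_le_iff hR0).2 fun l => (dist_pi_le_iff hR0).2 fun i =>
        (dist_pi_le_iff hR0).2 fun j => ?_
      by_cases he : (l, i, j) ∈ arcs S col
      · simp only [hZ, hmask, if_pos he]
        refine (Real.abs_le_sqrt ?_).trans (le_max_right _ _)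
        exact (sq_multiplier_sub_le_energy hρ (x (k + 1)) s (lam (k + 1)) mu he).trans
          (mul_le_mul_of_nonneg_left (hVanti (Nat.zero_le (k + 1))) hρ.le)
      · simp [hZ, hmask, if_neg he, hR0]
  obtain ⟨⟨x₀, lam₀⟩, -, φ, hφ, hlim⟩ := tendsto_subseq_of_bounded Metric.isBounded_closedBall hZb
  have hlimx : Tendsto (fun k => x (φ k + 1)) atTop (𝓝 x₀) :=
    (continuous_fst.tendsto _).comp hlim
  have hliml : Tendsto (fun k => mask (lam (φ k + 1))) atTop (𝓝 lam₀) :=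
    (continuous_snd.tendsto _).comp hlim
  have hlimat : ∀ p l, Tendsto (fun k => (x (φ k + 1)).at p l) atTop (𝓝 (x₀.at p l)) :=
    fun p l => ((continuous_at p l).tendsto _).comp hlimx
  have hlimarc : ∀ l i j, (l, i, j) ∈ arcs S col →
      Tendsto (fun k => lam (φ k + 1) l i j) atTop (𝓝 (lam₀ l i j)) := by
    intro l i j he
    have h := tendsto_pi_nhds.1 (tendsto_pi_nhds.1 (tendsto_pi_nhds.1 hliml l) i) j
    simpa only [hmask, if_pos he] using h
  obtain ⟨y, nu, hy, hy0, hnu0⟩ := hexists x₀ lam₀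
  have hE0 : Tendsto (fun k => energy col ρ (x (φ k + 1)) x₀ (lam (φ k + 1)) lam₀) atTop (𝓝 0) := by
    have : Tendsto (fun k => energy col ρ (x (φ k + 1)) x₀ (lam (φ k + 1)) lam₀) atTop
        (𝓝 (∑ e ∈ arcs S col, ((lam₀ e.1 e.2.1 e.2.2 - lam₀ e.1 e.2.1 e.2.2) ^ 2 / ρ
          + ρ * (x₀.at e.2.2 e.1 - x₀.at e.2.2 e.1) ^ 2))) :=
      tendsto_finsetSum _ fun e he =>
        ((((hlimarc e.1 e.2.1 e.2.2 he).sub_const _).pow 2).div_const ρ).add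
          ((((hlimat e.2.2 e.1).sub_const _).pow 2).const_mul ρ)
    simpa using this
  have hshift : ∀ r, IsOrbit f col ρ (fun m => x (r + m)) fun m => lam (r + m) := fun r =>
    ⟨fun k => hx.subgradient (r + k), fun k => hx.multiplier (r + k)⟩
  -- Nonexpansiveness makes the restarted orbit shadow the shifted original one for any fixed number
  -- of steps.
  have hE : ∀ m, Tendsto (fun k => energy col ρ (x (φ k + 1 + m)) (y m) (lam (φ k + 1 + m)) (nu m))
      atTop (𝓝 0) := by
    intro m
    refine squeeze_zero (fun k => energy_nonneg hρ _ _ _ _) (fun k => ?_) hE0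
    have := (hshift (φ k + 1)).antitone_energy hρ hf hy (Nat.zero_le m)
    simpa [hy0, hnu0] using this
  have hsq : ∀ {u : ℕ → ℝ} {a : ℝ} {ε : ℕ → ℝ}, (∀ k, (u k - a) ^ 2 ≤ ε k) →
      Tendsto ε atTop (𝓝 0) → Tendsto u atTop (𝓝 a) := by
    intro u a ε hle hε
    have h1 : Tendsto (fun k => (u k - a) ^ 2) atTop (𝓝 0) :=
      squeeze_zero (fun k => sq_nonneg _) hle hε
    have h2 := h1.sqrt
    simp only [Real.sqrt_sq_eq_abs, Real.sqrt_zero] at h2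
    exact tendsto_sub_nhds_zero_iff.1 ((tendsto_zero_iff_abs_tendsto_zero _).2 h2)
  have hVlim : Tendsto V atTop (𝓝 (⨅ k, V k)) :=
    tendsto_atTop_ciInf hVanti ⟨0, by rintro _ ⟨k, rfl⟩; exact hVnn k⟩
  have hsub : ∀ m, Tendsto (fun k => φ k + 1 + m) atTop atTop := fun m =>
    tendsto_atTop_mono (fun k => by omega) hφ.tendsto_atTop
  -- All shifted subsequences share the limit of the convergent sequence `V`, so no energy is lost
  -- along `y`.
  have hyV : ∀ m, energy col ρ (y m) s (nu m) mu = ⨅ k, V k := by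
    intro m
    refine tendsto_nhds_unique ?_ (hVlim.comp (hsub m))
    refine tendsto_finsetSum _ fun ⟨l, i, j⟩ he => ?_
    have h1 : Tendsto (fun k => lam (φ k + 1 + m) l i j) atTop (𝓝 (nu m l i j)) :=
      hsq (fun k => sq_multiplier_sub_le_energy hρ _ _ _ _ he) (by simpa using (hE m).const_mul ρ)
    have h2 : Tendsto (fun k => (x (φ k + 1 + m)).at j l) atTop (𝓝 ((y m).at j l)) :=
      hsq (fun k => sq_at_sub_le_energy hρ _ _ _ _ he) (by simpa using (hE m).div_const ρ)
    exact (((h1.sub_const _).pow 2).div_const ρ).add (((h2.sub_const _).pow 2).const_mul ρ)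
  have hdelay : ∀ m l i j, (l, i, j) ∈ arcs S col → (y (m + 1)).at i l = (y m).at j l := by
    intro m l i j he
    have h := hy.sq_at_sub_le hρ hf hs m he
    simp only [hyV, sub_self, zero_div, hs.at_eq_at hρ he, sub_zero] at h
    have := pow_eq_zero_iff two_ne_zero |>.1 (le_antisymm h (sq_nonneg _))
    linarith
  obtain ⟨N, hN⟩ := hy.exists_isFixed hρ hf hnbrs hdelay
  refine ⟨y N, nu N, hN, ?_⟩
  set W : ℕ → ℝ := fun k => energy col ρ (x k) (y N) (lam k) (nu N) with hW
  have hWanti : Antitone W := hx.antitone_energy hρ hf hN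
  have hWlim : Tendsto W atTop (𝓝 0) := by
    have h1 : Tendsto W atTop (𝓝 (⨅ k, W k)) :=
      tendsto_atTop_ciInf hWanti ⟨0, by rintro _ ⟨k, rfl⟩; exact energy_nonneg hρ _ _ _ _⟩
    rwa [tendsto_nhds_unique (h1.comp (hsub N)) (hE N)] at h1
  rw [← tendsto_add_atTop_iff_nat 1]
  refine tendsto_pi_nhds.2 fun p => tendsto_pi_nhds.2 fun l => ?_
  exact hsq (fun k => hx.sq_sub_le hρ hf hnbrs hN k p l)
    (by simpa using (hWlim.div_const ρ).const_mul 4)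

end Convergence

/-! ### Existence of the iterates, and the algorithm as an orbit. -/

section Algorithm

variable {P n C : ℕ} {S : Fin P → Finset (Fin n)} {f : ∀ p : Fin P, (S p → ℝ) → EReal}
  {G : SimpleGraph (Fin P)} {col : G.Coloring (Fin C)} {ρ : ℝ}

theorem nbrs_nonempty (hconn : VariableConnected S G) (hshared : ∀ l, (nodesOf S l).Nontrivial)
    (p : Fin P) (l : Fin n) (hl : l ∈ S p) : (nbrs S G p l).Nonempty := by
  have : Nontrivial (nodesOf S l) := Set.nontrivial_coe_sort.2 (hshared l)
  obtain ⟨j, hj⟩ := (hconn l).preconnected.exists_adj_of_nontrivial ⟨p, hl⟩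
  exact ⟨j, mem_nbrs.2 ⟨hj, j.2⟩⟩

/-- One iteration of the algorithm can be carried out: induction on the colors. -/
theorem exists_step (col : G.Coloring (Fin C)) (hρ : 0 < ρ) (hf : ∀ p, ClosedProperConvex (f p))
    (hnbrs : ∀ p, ∀ l ∈ S p, (nbrs S G p l).Nonempty) (γ x : Copies S) :
    ∃ x' : Copies S, ∀ p y, localObjective f G ρ p (vVec G col ρ γ x x' p) (x' p)
      ≤ localObjective f G ρ p (vVec G col ρ γ x x' p) y := by
  have hmin : ∀ p (v : S p → ℝ), ∃ y, ∀ z, localObjective f G ρ p v y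
      ≤ localObjective f G ρ p v z := fun p v =>
    (hf p).exists_minimizer v (fun l => ((nbrs S G p l).card : ℝ)) hρ fun l => by
      exact_mod_cast (hnbrs p l l.2).card_pos
  choose m hm using hmin
  have key : ∀ c : ℕ, ∃ x' : Copies S, ∀ p, (col p : ℕ) < c → ∀ y,
      localObjective f G ρ p (vVec G col ρ γ x x' p) (x' p)
        ≤ localObjective f G ρ p (vVec G col ρ γ x x' p) y := by
    intro c
    induction c with
    | zero => exact ⟨0, fun p hp => absurd hp (Nat.not_lt_zero _)⟩
    | succ c ih =>
      obtain ⟨x₁, hx₁⟩ := ih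
      let x₂ : Copies S := fun p =>
        if (col p : ℕ) = c then m p (vVec G col ρ γ x x₁ p) else x₁ p
      have hat : ∀ j l, (col j : ℕ) < c → x₂.at j l = x₁.at j l := fun j l hj => by
        simp only [Copies.at, x₂, if_neg hj.ne]
      -- New copies enter `vVec` only from strictly smaller colors, so updating color `c` leaves the
      -- problems of colors up to `c` unchanged.
      have hv : ∀ p, (col p : ℕ) ≤ c → vVec G col ρ γ x x₂ p = vVec G col ρ γ x x₁ p := by
        intro p hp
        funext l
        unfold vVec
        rw [Finset.sum_congr rfl fun j hj => hat j l ?_]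
        have : (col j : ℕ) < col p := (Finset.mem_filter.1 hj).2
        omega
      refine ⟨x₂, fun p hp y => ?_⟩
      rw [hv p (by omega)]
      by_cases hc : (col p : ℕ) = c
      · simp only [x₂, if_pos hc]
        exact hm p _ y
      · simp only [x₂, if_neg hc]
        exact hx₁ p (by omega) y
  obtain ⟨x', hx'⟩ := key C
  exact ⟨x', fun p => hx' p (col p).2⟩

theorem exists_isRun (hρ : 0 < ρ) (hf : ∀ p, ClosedProperConvex (f p))
    (hnbrs : ∀ p, ∀ l ∈ S p, (nbrs S G p l).Nonempty) : ∃ x γ, IsRun f G col ρ x γ := by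
  choose next hnext using exists_step (f := f) col hρ hf hnbrs
  let state : ℕ → Copies S × Copies S := fun k => Nat.rec (0, 0) (fun _ z =>
    (next z.2 z.1, fun p l => z.2 p l
      + ρ * ∑ j ∈ nbrs S G p l, (next z.2 z.1 p l - (next z.2 z.1).at j l))) k
  exact ⟨fun k => (state k).1, fun k => (state k).2, rfl, rfl,
    fun k => hnext (state k).2 (state k).1, fun k p l => rfl⟩

/-- The dual variable of the copy `p` of the component `l` for given multipliers of the edges. -/
noncomputable def nodeDual (col : G.Coloring (Fin C)) (lam : Fin n → Fin P → Fin P → ℝ) :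
    Copies S := fun p l =>
  ∑ j ∈ nbrs S G p l, if col p < col j then lam l p j else -lam l j p

/-- Split the term `ρ D x` of Fermat's rule into one share per neighbor. A later neighbor then
contributes λ + ρ(x'_p - x_j) = λ' + ρ(x'_j - x_j), an earlier one -(λ + ρ(x'_j - x'_p)) = -λ'. -/
theorem isSubgradient_of_step (hf : ∀ p, ClosedProperConvex (f p)) {x x' : Copies S}
    {lam lam' : Fin n → Fin P → Fin P → ℝ}
    (hmul : ∀ l i j, (l, i, j) ∈ arcs S col → lam' l i j = lam l i j + ρ * (x'.at i l - x'.at j l))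
    {p : Fin P} (hmin : ∀ y, localObjective f G ρ p (vVec G col ρ (nodeDual col lam) x x' p) (x' p)
      ≤ localObjective f G ρ p (vVec G col ρ (nodeDual col lam) x x' p) y) :
    IsSubgradient (f p) (x' p) fun l =>
      -∑ j ∈ nbrs S G p l, edgeForce col ρ lam' x x' l p j := by
  have h := isSubgradient_of_minimizer (hf p) (vVec G col ρ (nodeDual col lam) x x' p)
    (fun l => ((nbrs S G p l).card : ℝ)) ρ hmin
  convert h using 3 with l
  have hcard : ρ * ((nbrs S G p l).card : ℝ) * x' p l = ∑ j ∈ nbrs S G p l, ρ * x' p l := by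
    rw [Finset.sum_const, nsmul_eq_mul]; ring
  rw [hcard]
  simp only [vVec, nodeDual, Finset.sum_filter, Finset.mul_sum]
  rw [← Finset.sum_sub_distrib, ← Finset.sum_sub_distrib, ← Finset.sum_add_distrib]
  refine Finset.sum_congr rfl fun j hj => ?_
  have hj' := mem_nbrs.1 hj
  rcases lt_or_gt_of_ne (col.valid hj'.1) with hlt | hlt
  · rw [edgeForce, if_pos hlt, if_pos hlt, if_neg hlt.not_gt, if_pos hlt,
      hmul _ _ _ (mem_arcs.2 ⟨hj'.1, l.2, hj'.2, hlt⟩), Copies.at_coe]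
    ring
  · rw [edgeForce, if_neg hlt.not_gt, if_neg hlt.not_gt, if_pos hlt, if_neg hlt.not_gt,
      hmul _ _ _ (mem_arcs.2 ⟨hj'.1.symm, hj'.2, l.2, hlt⟩), Copies.at_coe]
    ring

theorem exists_isOrbit (hρ : 0 < ρ) (hf : ∀ p, ClosedProperConvex (f p))
    (hnbrs : ∀ p, ∀ l ∈ S p, (nbrs S G p l).Nonempty) (x₀ : Copies S)
    (lam₀ : Fin n → Fin P → Fin P → ℝ) :
    ∃ y mu, IsOrbit f col ρ y mu ∧ y 0 = x₀ ∧ mu 0 = lam₀ := by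
  choose next hnext using exists_step (f := f) col hρ hf hnbrs
  let state : ℕ → Copies S × (Fin n → Fin P → Fin P → ℝ) := fun k => Nat.rec (x₀, lam₀)
    (fun _ z => (next (nodeDual col z.2) z.1, fun l i j => z.2 l i j
      + ρ * ((next (nodeDual col z.2) z.1).at i l - (next (nodeDual col z.2) z.1).at j l))) k
  refine ⟨fun k => (state k).1, fun k => (state k).2, ⟨fun k p => ?_, fun k l i j _ => rfl⟩,
    rfl, rfl⟩
  exact isSubgradient_of_step (lam := (state k).2) hf (fun l i j _ => rfl)
    (hnext (nodeDual col (state k).2) (state k).1 p)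

/-- The zero start matters: it puts γ in the range of `nodeDual`, and the updates keep it there. The
edge multipliers are the accumulated disagreements. -/
theorem IsRun.exists_isOrbit (hf : ∀ p, ClosedProperConvex (f p)) {x γ : ℕ → Copies S}
    (h : IsRun f G col ρ x γ) : ∃ lam, IsOrbit f col ρ x lam := by
  let lam : ℕ → Fin n → Fin P → Fin P → ℝ := fun k l i j =>
    ∑ m ∈ Finset.range k, ρ * ((x (m + 1)).at i l - (x (m + 1)).at j l)
  have hlam : ∀ k l i j, lam (k + 1) l i j
      = lam k l i j + ρ * ((x (k + 1)).at i l - (x (k + 1)).at j l) := fun k l i j =>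
    Finset.sum_range_succ _ _
  have hγ : ∀ k, γ k = nodeDual col (lam k) := by
    intro k
    induction k with
    | zero => rw [h.init_γ]; funext p l; simp [nodeDual, lam]
    | succ k ih =>
      funext p l
      rw [h.step_γ, ih]
      simp only [nodeDual, Finset.mul_sum]
      rw [← Finset.sum_add_distrib]
      refine Finset.sum_congr rfl fun j _ => ?_
      rw [hlam, hlam, ← Copies.at_coe (x (k + 1))]
      split_ifs <;> ring
  refine ⟨lam, fun k p => ?_, fun k l i j _ => hlam k l i j⟩
  refine isSubgradient_of_step (lam := lam k) hf (fun l i j _ => hlam k l i j) ?_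
  rw [← hγ]
  exact h.step_x k p

end Algorithm

/-! ### Primal-dual solutions, fixed points and solutions of the original problem. -/

section Solutions

theorem coe_finset_sum {ι : Type*} (s : Finset ι) (a : ι → ℝ) :
    ((∑ i ∈ s, a i : ℝ) : EReal) = ∑ i ∈ s, (a i : EReal) := by
  classical
  induction s using Finset.induction_on with
  | empty => simp
  | insert i s hi ih => rw [Finset.sum_insert hi, Finset.sum_insert hi, EReal.coe_add, ih]

theorem finset_sum_ne_bot {ι : Type*} (s : Finset ι) {a : ι → EReal} (h : ∀ i, a i ≠ ⊥) :
    ∑ i ∈ s, a i ≠ ⊥ := by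
  classical
  induction s using Finset.induction_on with
  | empty => simp
  | insert i s hi ih => rw [Finset.sum_insert hi, Ne, EReal.add_eq_bot_iff]; simp [h i, ih]

theorem ne_top_of_finset_sum_ne_top {ι : Type*} {s : Finset ι} {a : ι → EReal} (h : ∀ i, a i ≠ ⊥)
    (hs : ∑ i ∈ s, a i ≠ ⊤) {i : ι} (hi : i ∈ s) : a i ≠ ⊤ := by
  classical
  intro htop
  rw [← Finset.add_sum_erase s a hi, htop, EReal.top_add_of_ne_bot (finset_sum_ne_bot _ h)] at hs
  exact hs rfl

variable {P n C : ℕ} {S : Fin P → Finset (Fin n)} {f : ∀ p : Fin P, (S p → ℝ) → EReal}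
  {G : SimpleGraph (Fin P)} {col : G.Coloring (Fin C)} {ρ : ℝ}

theorem IsPrimalDualSolution.exists_isFixed (hf : ∀ p, ClosedProperConvex (f p)) {x : Copies S}
    {lam : Fin n → Fin P → Fin P → ℝ} (h : IsPrimalDualSolution f G x lam) :
    ∃ mu, IsFixed f col ρ x mu := by
  classical
  -- Extends the multipliers antisymmetrically, from edges ordered by node index to edges oriented
  -- by color.
  let mu : Fin n → Fin P → Fin P → ℝ := fun l i j => if i < j then lam l i j else -lam l j i
  have hlin : ∀ y : Copies S, (∑ l, ∑ i, ∑ j, if i < j ∧ G.Adj i j ∧ l ∈ S i ∧ l ∈ S j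
      then lam l i j * (y.at i l - y.at j l) else 0)
      = ∑ p, ∑ l, nodeDual (G := G) col mu p l * y p l := by
    intro y
    set F : Fin n → Fin P → Fin P → ℝ := fun l i j =>
      if i < j then lam l i j * (y.at i l - y.at j l) else 0 with hF
    have h1 := (sum_nbrs_eq_sum_arcs (S := S) col F).symm.trans (sum_nbrs_eq_sum_ite F)
    have h2 : ∑ p, ∑ l, nodeDual (G := G) col mu p l * y p l = ∑ p, ∑ l : S p,
        ∑ j ∈ nbrs S G p l, (if col p < col j then mu l p j else -mu l j p) * y.at p l := by
      refine Finset.sum_congr rfl fun p _ => Finset.sum_congr rfl fun l _ => ?_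
      rw [nodeDual, Finset.sum_mul, Copies.at_coe]
    rw [h2, sum_nbrs_eq_sum_arcs col
      (fun l p j => (if col p < col j then mu l p j else -mu l j p) * y.at p l)]
    trans ∑ l, ∑ i, ∑ j, if l ∈ S i ∧ G.Adj i j ∧ l ∈ S j then F l i j else 0
    · refine Finset.sum_congr rfl fun l _ => Finset.sum_congr rfl fun i _ =>
        Finset.sum_congr rfl fun j _ => ?_
      rw [hF, ← ite_and]
      exact if_congr (by tauto) rfl rfl
    · rw [← h1]
      refine Finset.sum_congr rfl fun ⟨l, i, j⟩ he => ?_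
      have he' := mem_arcs.1 he
      simp only [if_pos he'.2.2.2, if_neg he'.2.2.2.not_gt, mu, hF]
      rcases lt_or_gt_of_ne he'.1.ne with hlt | hlt
      · simp only [if_pos hlt, if_neg hlt.not_gt]; ring
      · simp only [if_pos hlt, if_neg hlt.not_gt]; ring
  have hL : ∀ y : Copies S, lagrangian f G y lam
      = ∑ p, f p (y p) + ((∑ p, ∑ l, nodeDual (G := G) col mu p l * y p l : ℝ) : EReal) :=
    fun y => by rw [lagrangian, hlin]
  have hle : ∀ y : Copies S, ∑ p, f p (x p)
      + ((∑ p, ∑ l, nodeDual (G := G) col mu p l * x p l : ℝ) : EReal)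
      ≤ ∑ p, f p (y p) + ((∑ p, ∑ l, nodeDual (G := G) col mu p l * y p l : ℝ) : EReal) :=
    fun y => by rw [← hL, ← hL]; exact h.2 y
  have hsum : ∑ p, f p (x p) ≠ ⊤ := by
    choose y hy using fun p => (hf p).exists_ne_top
    choose b hb using fun p => (hf p).exists_coe (hy p)
    intro htop
    have := hle y
    rw [htop, Finset.sum_congr rfl fun p _ => hb p, ← coe_finset_sum, EReal.top_add_coe,
      ← EReal.coe_add] at this
    exact EReal.coe_ne_top _ (top_le_iff.1 this)
  have hfin : ∀ p, f p (x p) ≠ ⊤ := fun p =>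
    ne_top_of_finset_sum_ne_top (fun q => (hf q).ne_bot (x q)) hsum (Finset.mem_univ p)
  choose a ha using fun p => (hf p).exists_coe (hfin p)
  have hsub : ∀ p, IsSubgradient (f p) (x p) fun l => -nodeDual (G := G) col mu p l := by
    refine fun p => ⟨hfin p, fun w => ?_⟩
    by_cases hw : f p w = ⊤
    · rw [hw]; exact le_top
    obtain ⟨b, hb⟩ := (hf p).exists_coe hw
    -- In terms of `nodeDual` the Lagrangian separates over the nodes, so varying a single copy
    -- isolates one subgradient inequality.
    have h1 := hle (Function.update x p w)
    have h2 : ∀ q, f q (Function.update x p w q) = (Function.update a p b q : ℝ) := by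
      intro q
      rcases eq_or_ne q p with rfl | hq
      · simp [hb]
      · simp [hq, ha]
    rw [Finset.sum_congr rfl fun q _ => ha q, Finset.sum_congr rfl fun q _ => h2 q,
      ← coe_finset_sum, ← coe_finset_sum, ← EReal.coe_add, ← EReal.coe_add,
      EReal.coe_le_coe_iff, ← Finset.add_sum_erase _ _ (Finset.mem_univ p),
      ← Finset.add_sum_erase _ (fun q => Function.update a p b q) (Finset.mem_univ p),
      ← Finset.add_sum_erase _ (fun q => ∑ l, nodeDual (G := G) col mu q l * x q l)
        (Finset.mem_univ p),
      ← Finset.add_sum_erase _ (fun q => ∑ l, nodeDual (G := G) col mu q l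
        * Function.update x p w q l) (Finset.mem_univ p)] at h1
    have h3 : ∑ q ∈ Finset.univ.erase p, Function.update a p b q
        = ∑ q ∈ Finset.univ.erase p, a q :=
      Finset.sum_congr rfl fun q hq => by simp [Finset.ne_of_mem_erase hq]
    have h4 : ∑ q ∈ Finset.univ.erase p, ∑ l, nodeDual (G := G) col mu q l
          * Function.update x p w q l
        = ∑ q ∈ Finset.univ.erase p, ∑ l, nodeDual (G := G) col mu q l * x q l :=
      Finset.sum_congr rfl fun q hq => by simp [Finset.ne_of_mem_erase hq]
    simp only [h3, h4, Function.update_self] at h1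
    rw [ha, hb, ← EReal.coe_add, EReal.coe_le_coe_iff]
    have h5 : ∑ l, -nodeDual (G := G) col mu p l * (w l - x p l)
        = ∑ l, nodeDual (G := G) col mu p l * x p l
          - ∑ l, nodeDual (G := G) col mu p l * w l := by
      rw [← Finset.sum_sub_distrib]
      exact Finset.sum_congr rfl fun l _ => by ring
    linarith
  refine ⟨mu, fun _ p => ?_, fun _ l i j he => ?_⟩
  · simpa [edgeForce, nodeDual] using hsub p
  · have he' := mem_arcs.1 he
    rw [h.1 l i j he'.1 he'.2.1 he'.2.2.1]
    ring

/-- Agreement across arcs propagates along walks in each connected induced subgraph, so the copies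
glue to one vector. Adding the subgradient inequalities at a common `y` proves optimality. -/
theorem IsFixed.exists_isSolution (hρ : 0 < ρ) (hf : ∀ p, ClosedProperConvex (f p))
    (hconn : VariableConnected S G) {s : Copies S} {mu : Fin n → Fin P → Fin P → ℝ}
    (h : IsFixed f col ρ s mu) :
    ∃ xstar : Fin n → ℝ, IsSolution f xstar ∧ ∀ p, restr (S p) xstar = s p := by
  have hagree : ∀ l (p q : nodesOf S l), s.at p l = s.at q l := by
    intro l p q
    obtain ⟨w⟩ := (hconn l).preconnected p q
    induction w with
    | nil => rfl
    | @cons u v w huv _ ih =>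
      rw [← ih]
      rcases mem_arcs_or (col := col) (S := S) (SimpleGraph.induce_adj.1 huv) u.2 v.2 with he | he
      · exact h.at_eq_at hρ he
      · exact (h.at_eq_at hρ he).symm
  let c : ∀ l, nodesOf S l := fun l => (hconn l).nonempty.some
  have hrestr : ∀ p, restr (S p) (fun l => s.at (c l) l) = s p := fun p => funext fun l => by
    rw [restr, ← Copies.at_coe s]
    exact hagree l (c l) ⟨p, l.2⟩
  refine ⟨fun l => s.at (c l) l, ?_, hrestr⟩
  have hobj : objective f (fun l => s.at (c l) l) = ∑ p, f p (s p) :=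
    Finset.sum_congr rfl fun p _ => by rw [hrestr]
  rw [IsSolution, hobj]
  have hsub := h.subgradient 0
  constructor
  · choose a ha using fun p => (hf p).exists_coe (hsub p).1
    rw [Finset.sum_congr rfl fun p _ => ha p, ← coe_finset_sum]
    exact EReal.coe_ne_top _
  intro y
  -- At a fixed point the two ends of an edge feel opposite forces, and they are tested against the
  -- same number.
  have hzero : ∑ p, ∑ l : S p, (-∑ j ∈ nbrs S G p l, edgeForce col ρ mu s s l p j)
      * (restr (S p) y l - s p l) = 0 := by
    have h1 := sum_nbrs_eq_sum_arcs (S := S) col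
      fun l p j => edgeForce col ρ mu s s l p j * (s.at p l - y l)
    rw [Finset.sum_eq_zero (s := arcs S col)] at h1
    · rw [← h1]
      refine Finset.sum_congr rfl fun p _ => Finset.sum_congr rfl fun l _ => ?_
      rw [← Finset.sum_mul, Copies.at_coe, restr]
      ring
    · rintro ⟨l, i, j⟩ he
      have hlt := (mem_arcs.1 he).2.2.2
      simp only [edgeForce, if_pos hlt, if_neg hlt.not_gt, h.at_eq_at hρ he]
      ring
  calc ∑ p, f p (s p)
      = ∑ p, (f p (s p) + ((∑ l : S p, (-∑ j ∈ nbrs S G p l, edgeForce col ρ mu s s l p j)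
        * (restr (S p) y l - s p l) : ℝ) : EReal)) := by
        rw [Finset.sum_add_distrib, ← coe_finset_sum, hzero, EReal.coe_zero, add_zero]
    _ ≤ objective f y := Finset.sum_le_sum fun p _ => (hsub p).2 (restr (S p) y)

end Solutions

end PartialADMM

theorem corollary1 {P n C : ℕ} (S : Fin P → Finset (Fin n))
    (f : ∀ p : Fin P, (S p → ℝ) → EReal)
    (G : SimpleGraph (Fin P)) (col : G.Coloring (Fin C)) (ρ : ℝ) (hρ : 0 < ρ)
    (hpartial : ⋂ p, (S p : Set (Fin n)) = ∅)
    (hG : G.Connected)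
    (hf : ∀ p, PartialADMM.ClosedProperConvex (f p))
    (hconn : PartialADMM.VariableConnected S G)
    (hshared : ∀ l, (PartialADMM.nodesOf S l).Nontrivial)
    (hsolvable : ∃ x lam, PartialADMM.IsPrimalDualSolution f G x lam)
    (hcase : C = 2 ∨ ∀ c, PartialADMM.ColorSumStronglyConvex f col c) :
    (∃ x γ, PartialADMM.IsRun f G col ρ x γ) ∧
      ∀ x γ, PartialADMM.IsRun f G col ρ x γ →
        ∃ xstar : Fin n → ℝ, PartialADMM.IsSolution f xstar ∧
          ∀ p, Filter.Tendsto (fun k => x k p) Filter.atTop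
            (nhds (PartialADMM.restr (S p) xstar)) := by
  have hnbrs := PartialADMM.nbrs_nonempty hconn hshared
  refine ⟨PartialADMM.exists_isRun hρ hf hnbrs, fun x γ hrun => ?_⟩
  obtain ⟨s, lam, hs⟩ := hsolvable
  obtain ⟨mu, hmu⟩ := hs.exists_isFixed (col := col) (ρ := ρ) hf
  obtain ⟨nu, hnu⟩ := hrun.exists_isOrbit hf
  obtain ⟨s', mu', hs', hlim⟩ :=
    hnu.exists_tendsto hρ hf hnbrs (PartialADMM.exists_isOrbit hρ hf hnbrs) hmu
  obtain ⟨xstar, hsol, hrestr⟩ := hs'.exists_isSolution hρ hf hconn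
  exact ⟨xstar, hsol, fun p => hrestr p ▸ tendsto_pi_nhds.1 hlim p⟩
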